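/- Let $d\ge 0$ be an integer and let $h(t)=h_0+h_1t+\cdots+h_st^s\in\mathbb{R}[t]$ be a polynomial of degree $s\le\frac{d+1}{2}$ with nonnegative coefficients such that \[ (S)\qquad h_0+h_1+\cdots+h_i\;\le\; h_s+h_{s-1}+\cdots+h_{s-i}\qquad\text{for all } i, \] where $h_j:=0$ for $j\notin\{0,\dots,s\}$. For an integer $r\ge1$ let $U_r^{d+1}h(t)$ be the unique polynomial such that \[ \sum_{n\ge0}a_{rn}t^n=\frac{U_r^{d+1}h(t)}{(1-t)^{d+1}}\quad\text{whenever}\quad \sum_{n\ge0}a_nt^n=\frac{h(t)}{(1-t)^{d+1}} . \] Then for every $r\ge d+1$ the polynomial $U_r^{d+1}h(t)$ has a nonnegative interlacing symmetric decomposition with respect to degree $d$; that is, there are polynomials $p,q\in\mathbb{R}[t]$ with nonnegative coefficients such that \[ U_r^{d+1}h(t)=p(t)+t\,q(t),\qquad p(t)=t^dp(1/t),\qquad q(t)=t^{d-1}q(1/t), \] both $p$ and $q$ are real-rooted, and $q$ interlaces $p$, written $q\preceq p$. Here, for nonzero real-rooted polynomials $f$ with roots $s_k\le\cdots\le s_1$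 and $g$ with roots $t_m\le\cdots\le t_1$ (counted with multiplicity), $f\preceq g$ means $\cdots\le s_2\le t_2\le s_1\le t_1$, so that $m\in\{k,k+1\}$. By convention the zero polynomial counts as real-rooted, and $0\preceq f$ and $f\preceq 0$ for every real-rooted $f$. -/

import Mathlib

open Polynomial

noncomputable section

/-! ### The operator `U_r^D` -/

/-- `g` is the numerator polynomial of the subsequence `(a_{rn})`: whenever
`∑ a_n t^n = h(t) / (1-t)^D`, one has `∑ a_{rn} t^n = g(t) / (1-t)^D`. The quotients are
formal power series, so both equations are multiplied by the unit `(1-t)^D`. -/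
def IsSubseqNumerator (r D : ℕ) (h g : ℝ[X]) : Prop :=
  ∀ a : ℕ → ℝ, PowerSeries.mk a * (1 - PowerSeries.X) ^ D = (h : PowerSeries ℝ) →
    PowerSeries.mk (fun n => a (r * n)) * (1 - PowerSeries.X) ^ D = (g : PowerSeries ℝ)

/-- Passing to every `r`-th coefficient turns a factor `1 - t^r` into a factor `1 - t`. -/
theorem mk_coeff_mul_one_sub_X_pow (r : ℕ) (hr : 0 < r) (D : ℕ) (F : PowerSeries ℝ) :
    PowerSeries.mk (fun n => PowerSeries.coeff (r * n) (F * (1 - PowerSeries.X ^ r) ^ D)) =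
      PowerSeries.mk (fun n => PowerSeries.coeff (r * n) F) * (1 - PowerSeries.X) ^ D := by
  induction D generalizing F with
  | zero => simp
  | succ D ih =>
    rw [pow_succ' (1 - PowerSeries.X ^ r), ← mul_assoc, ih, pow_succ' (1 - PowerSeries.X),
      ← mul_assoc]
    congr 1
    ext n
    cases n with
    | zero =>
      simp [mul_sub, PowerSeries.coeff_mul_X_pow', hr]
    | succ n =>
      have h1 : r ≤ r * (n + 1) := Nat.le_mul_of_pos_right r (Nat.succ_pos n)
      have h2 : r * (n + 1) - r = r * n := by
        rw [Nat.mul_succ, Nat.add_sub_cancel]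
      simp [mul_sub, PowerSeries.coeff_mul_X_pow', PowerSeries.coeff_succ_mul_X, h1, h2]

/-- Every `h(t) / (1-t)^D` is the generating function of a sequence. -/
theorem exists_seq_mk_mul_eq (D : ℕ) (h : ℝ[X]) :
    ∃ a : ℕ → ℝ, PowerSeries.mk a * (1 - PowerSeries.X) ^ D = (h : PowerSeries ℝ) := by
  refine ⟨fun n => PowerSeries.coeff n
    ((h : PowerSeries ℝ) * (PowerSeries.invOneSubPow ℝ D).val), ?_⟩
  have e : PowerSeries.mk (fun n => PowerSeries.coeff n
      ((h : PowerSeries ℝ) * (PowerSeries.invOneSubPow ℝ D).val)) =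
      (h : PowerSeries ℝ) * (PowerSeries.invOneSubPow ℝ D).val := by
    ext n
    simp
  rw [e, mul_assoc, ← PowerSeries.invOneSubPow_inv_eq_one_sub_pow,
    (PowerSeries.invOneSubPow ℝ D).val_inv, mul_one]

/-- The numerator polynomial of the subsequence exists and is unique. -/
theorem existsUnique_isSubseqNumerator (r : ℕ) (hr : 0 < r) (D : ℕ) (h : ℝ[X]) :
    ∃! g : ℝ[X], IsSubseqNumerator r D h g := by
  refine existsUnique_of_exists_of_unique ⟨Polynomial.contract r (h * (∑ i ∈ Finset.range r, X ^ i) ^ D), ?_⟩ ?_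
  · intro a ha
    have hgeom : ((1 - PowerSeries.X ^ r : PowerSeries ℝ)) =
        (1 - PowerSeries.X) * ((∑ i ∈ Finset.range r, X ^ i : ℝ[X]) : PowerSeries ℝ) := by
      have e : (1 - X ^ r : ℝ[X]) = (1 - X) * ∑ i ∈ Finset.range r, X ^ i :=
        (mul_neg_geom_sum X r).symm
      have e' := congrArg (fun p : ℝ[X] => (p : PowerSeries ℝ)) e
      simpa only [Polynomial.coe_mul, Polynomial.coe_sub, Polynomial.coe_one, Polynomial.coe_X,
        Polynomial.coe_pow] using e'
    have key := mk_coeff_mul_one_sub_X_pow r hr D (PowerSeries.mk a)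
    rw [hgeom, mul_pow, ← mul_assoc, ha, ← Polynomial.coe_pow, ← Polynomial.coe_mul] at key
    simp only [PowerSeries.coeff_mk] at key
    rw [← key]
    ext n
    simp only [PowerSeries.coeff_mk, Polynomial.coeff_coe]
    rw [Polynomial.coeff_contract hr.ne', mul_comm r n]
  · intro g g' hg hg'
    obtain ⟨a, ha⟩ := exists_seq_mk_mul_eq D h
    exact Polynomial.coe_injective ℝ ((hg a ha).symm.trans (hg' a ha))

/-- The operator `U_r^D`, for `r ≥ 1`: the unique polynomial `U_r^D h` such that
`∑ a_{rn} t^n = (U_r^D h)(t) / (1-t)^D` whenever `∑ a_n t^n = h(t) / (1-t)^D`.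
(For `r = 0`, where such a polynomial need not exist, the value is set to `0`.) -/
def subseqOp (r D : ℕ) (h : ℝ[X]) : ℝ[X] :=
  if hr : 0 < r then (existsUnique_isSubseqNumerator r hr D h).choose else 0

theorem subseqOp_spec (r : ℕ) (hr : 0 < r) (D : ℕ) (h : ℝ[X]) :
    IsSubseqNumerator r D h (subseqOp r D h) := by
  rw [subseqOp, dif_pos hr]
  exact (existsUnique_isSubseqNumerator r hr D h).choose_spec.1

/-! ### Symmetric decompositions -/

/-- `f(t) = t^n f(1/t)`, an identity of Laurent polynomials; `n` is an integer since
`n = d - 1` with `d = 0` occurs. -/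
def IsSymmetricPoly (n : ℤ) (f : ℝ[X]) : Prop :=
  toLaurent f = LaurentPolynomial.T n * LaurentPolynomial.invert (toLaurent f)

/-- `(p, q)` is the symmetric decomposition of `h` with respect to degree `d`. -/
def IsSymmetricDecomposition (d : ℕ) (h p q : ℝ[X]) : Prop :=
  IsSymmetricPoly d p ∧ IsSymmetricPoly ((d : ℤ) - 1) q ∧ h = p + X * q

/-! ### Interlacing polynomials -/

/-- All roots are real. The zero polynomial counts as real-rooted. -/
def IsRealRooted (f : ℝ[X]) : Prop :=
  f = 0 ∨ ∀ z : ℂ, aeval z f = 0 → z.im = 0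

/-- The real roots, with multiplicity, in weakly decreasing order. -/
def rootsDesc (f : ℝ[X]) : List ℝ := f.roots.sort (· ≥ ·)

/-- `f` interlaces `g`: both are real-rooted and, unless one of them is zero, the roots
`s₁ ≥ s₂ ≥ ⋯` of `f` and `t₁ ≥ t₂ ≥ ⋯` of `g` satisfy `⋯ ≤ s₂ ≤ t₂ ≤ s₁ ≤ t₁`; so the number of
roots of `g` is that of `f` or one more. -/
def Interlaces (f g : ℝ[X]) : Prop :=
  IsRealRooted f ∧ IsRealRooted g ∧
    (f = 0 ∨ g = 0 ∨
      (((rootsDesc g).length = (rootsDesc f).length ∨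
          (rootsDesc g).length = (rootsDesc f).length + 1) ∧
        (∀ (i : ℕ) (hf : i < (rootsDesc f).length) (hg : i < (rootsDesc g).length),
          (rootsDesc f)[i] ≤ (rootsDesc g)[i]) ∧
        (∀ (i : ℕ) (hf : i < (rootsDesc f).length) (hg : i + 1 < (rootsDesc g).length),
          (rootsDesc g)[i + 1] ≤ (rootsDesc f)[i])))

/-- The polynomial `h` has a nonnegative interlacing symmetric decomposition with respect to
degree `d`. -/
def HasNonnegInterlacingSymmetricDecomposition (d : ℕ) (h : ℝ[X]) : Prop :=
  ∃ p q : ℝ[X], IsSymmetricDecomposition d h p q ∧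
    (∀ i, 0 ≤ p.coeff i) ∧ (∀ i, 0 ≤ q.coeff i) ∧ Interlaces q p

/-! ### Property (S) -/

/-- `h₀ + h₁ + ⋯ + hᵢ ≤ h_s + h_{s-1} + ⋯ + h_{s-i}` for all `i`, where `s = deg h`. For `i ≥ s`
both sides are the sum of all coefficients, so that `i ≤ s` suffices. -/
def PropertyS (h : ℝ[X]) : Prop :=
  ∀ i ≤ h.natDegree, ∑ j ∈ Finset.range (i + 1), h.coeff j ≤
    ∑ j ∈ Finset.range (i + 1), h.coeff (h.natDegree - j)

end

/-! Put `G = 1 + t + ⋯ + t^(r-1)` and let `V_m` (`veronese r d m`) keep every `r`-th coefficient of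
`t^m G^d`. Since `1 - t^r = (1 - t) G`, the polynomial `U_r^{d+1} h` keeps every `r`-th coefficient
of `h G^(d+1)`, so it equals `∑_j h_j ∑_{j ≤ m < j+r} V_m`. Each window is cut at `d+1-j`. The range
`[j, d+1-j)` is stable under `m ↦ d-m` and feeds `p`; the range `[d+1-j, r+j)` is stable under `m ↦
d+r-m` and feeds `t q`. As `G^d` is palindromic, these become the two required symmetries.

Real-rootedness and interlacing are read off at a point `z` of the upper half-plane. There the
values `V_m(z)` turn counterclockwise, with `V_{m+r}(z) = z V_m(z)` (`isTurning_veronese`): this is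
clear for `d = 0`, and summing over windows of length `r` preserves it (`IsTurning.sum_window`). For
`d ≥ 1`, any `r + 1` consecutive values lie in an open half-plane bounded by a line through the
origin, so `p` and `q`, if nonzero, do not vanish at `z` (`IsTurning.sum_ne_zero`). Comparing the
two kinds of ranges gives `Im (p(z) * conj q(z)) ≥ 0` (`IsTurning.crossProd_centered_nonneg`), and
following arguments down to the real axis turns this into interlacing (`interlaces_of_im_nonneg`).
-/

/-! ### Interlacing from the argument principle on the upper half-plane -/

/-- The sum of the arguments of `z - t`, over the elements `t` of a multiset. -/
noncomputable def argSum (m : Multiset ℝ) (z : ℂ) : ℝ := (m.map fun t : ℝ => Complex.arg (z - t)).sum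

@[simp] theorem argSum_zero (z : ℂ) : argSum 0 z = 0 := by simp [argSum]

@[simp] theorem argSum_cons (t : ℝ) (m : Multiset ℝ) (z : ℂ) :
    argSum (t ::ₘ m) z = Complex.arg (z - t) + argSum m z := by simp [argSum]

theorem prod_sub_eq_norm_mul_exp (m : Multiset ℝ) (z : ℂ) :
    (m.map fun t : ℝ => z - t).prod =
      ‖(m.map fun t : ℝ => z - t).prod‖ * Complex.exp (argSum m z * Complex.I) := by
  induction m using Multiset.induction with
  | empty => simp
  | cons t m ih =>
    simp only [Multiset.map_cons, Multiset.prod_cons, argSum_cons, norm_mul, Complex.ofReal_mul,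
      Complex.ofReal_add, add_mul, Complex.exp_add]
    conv_lhs => rw [ih, ← Complex.norm_mul_exp_arg_mul_I (z - t)]
    ring

theorem sub_ofReal_ne_zero {z : ℂ} (hz : 0 < z.im) (t : ℝ) : z - t ≠ 0 := by
  intro h
  have := congrArg Complex.im h
  simp at this
  exact hz.ne' this

theorem norm_prod_sub_pos (m : Multiset ℝ) {z : ℂ} (hz : 0 < z.im) :
    0 < ‖(m.map fun t : ℝ => z - t).prod‖ := by
  rw [norm_pos_iff]
  refine Multiset.prod_ne_zero ?_
  simp only [Multiset.mem_map, not_exists, not_and]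
  exact fun t _ => sub_ofReal_ne_zero hz t

theorem continuousOn_argSum (m : Multiset ℝ) : ContinuousOn (argSum m) {z | 0 < z.im} := by
  induction m using Multiset.induction with
  | empty => exact continuousOn_const.congr fun z _ => argSum_zero z
  | cons t m ih =>
    refine ContinuousOn.congr (ContinuousOn.add (f := fun z : ℂ => Complex.arg (z - t)) ?_ ih)
      fun z _ => argSum_cons t m z
    intro z hz
    refine ContinuousAt.continuousWithinAt ?_
    refine ContinuousAt.comp (g := Complex.arg) (Complex.continuousAt_arg ?_) (by fun_prop)
    right
    simpa using ne_of_gt hz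

/-- The number of elements of `m` exceeding `x`. -/
noncomputable def numAbove (m : Multiset ℝ) (x : ℝ) : ℕ := m.countP (x < ·)

/-- Just above the real axis, `arg (z - t)` tends to `π` if `x < t` and to `0` if `x > t`. For `x =
t` it would be `π / 2`, hence the exclusion of elements of `m`. -/
theorem tendsto_argSum (m : Multiset ℝ) {x : ℝ} (hx : x ∉ m) :
    Filter.Tendsto (fun ε : ℝ => argSum m (x + ε * Complex.I)) (nhdsWithin 0 (Set.Ioi 0))
      (nhds (Real.pi * numAbove m x)) := by
  induction m using Multiset.induction with
  | empty => simp [numAbove]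
  | cons t m ih =>
    rw [Multiset.mem_cons, not_or] at hx
    have hpath : Filter.Tendsto (fun ε : ℝ => (x + ε * Complex.I - t : ℂ))
        (nhdsWithin 0 (Set.Ioi 0)) (nhds ((x - t : ℝ) : ℂ)) := by
      have : Continuous (fun ε : ℝ => (x + ε * Complex.I - t : ℂ)) := by fun_prop
      have h := this.tendsto 0
      simp only [Complex.ofReal_zero, zero_mul, add_zero] at h
      rw [Complex.ofReal_sub]
      exact h.mono_left nhdsWithin_le_nhds
    simp only [argSum_cons]
    rcases lt_or_gt_of_ne hx.1 with hlt | hgt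
    · have e : Real.pi * numAbove (t ::ₘ m) x = Real.pi + Real.pi * numAbove m x := by
        simp only [numAbove, Multiset.countP_cons_of_pos _ hlt]
        push_cast
        ring
      rw [e]
      refine Filter.Tendsto.add ?_ (ih hx.2)
      -- The argument jumps across the negative axis, so only the limit from above is available.
      refine (Complex.tendsto_arg_nhdsWithin_im_nonneg_of_re_neg_of_im_zero
        (z := ((x - t : ℝ) : ℂ)) (by simpa using hlt) (by simp)).comp ?_
      refine tendsto_nhdsWithin_of_tendsto_nhds_of_eventually_within _ hpath ?_
      filter_upwards [self_mem_nhdsWithin] with ε hε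
      simpa using le_of_lt hε
    · have e : Real.pi * numAbove (t ::ₘ m) x = 0 + Real.pi * numAbove m x := by
        simp only [numAbove]
        rw [Multiset.countP_cons_of_neg _ (not_lt.mpr hgt.le), zero_add]
      rw [e]
      refine Filter.Tendsto.add ?_ (ih hx.2)
      have h0 : Complex.arg ((x - t : ℝ) : ℂ) = 0 := Complex.arg_ofReal_of_nonneg (by linarith)
      have harg := (Complex.continuousAt_arg (x := ((x - t : ℝ) : ℂ))
        (Or.inl (by simpa using hgt))).tendsto.comp hpath
      rwa [h0] at harg

/-- If `∏ (z - s)` never gets ahead of `∏ (z - t)` by an angle with negative sine, then the angle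
between them stays in `[0, π]`. -/
theorem argSum_sub_mem_Icc (m n : Multiset ℝ)
    (hs : ∀ z : ℂ, 0 < z.im → 0 ≤ Real.sin (argSum n z - argSum m z)) {z : ℂ} (hz : 0 < z.im) :
    argSum n z - argSum m z ∈ Set.Icc 0 Real.pi := by
  set Θ : ℂ → ℝ := fun z => argSum n z - argSum m z with hΘ
  have hcont : ContinuousOn Θ {z | 0 < z.im} := (continuousOn_argSum n).sub (continuousOn_argSum m)
  have hconn : (Θ '' {z | 0 < z.im}).OrdConnected :=
    ((convex_halfSpace_im_gt 0).isPreconnected.image _ hcont).ordConnected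
  -- To the right of all elements every argument tends to `0`; this pins down the branch of `Θ`.
  obtain ⟨x, hx⟩ : ∃ x : ℝ, ∀ t ∈ m + n, t < x := by
    obtain ⟨b, hb⟩ := (m + n).toFinset.bddAbove
    exact ⟨b + 1, fun t ht => by
      have := hb (Finset.mem_coe.mpr (Multiset.mem_toFinset.mpr ht)); linarith⟩
  have hzero : ∀ k : Multiset ℝ, (∀ t ∈ k, t < x) → numAbove k x = 0 := by
    intro k hk
    rw [numAbove, Multiset.countP_eq_zero]
    exact fun t ht => not_lt.mpr (hk t ht).le
  have hxm : ∀ t ∈ m, t < x := fun t ht => hx t (Multiset.mem_add.mpr (Or.inl ht))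
  have hxn : ∀ t ∈ n, t < x := fun t ht => hx t (Multiset.mem_add.mpr (Or.inr ht))
  have hlim : Filter.Tendsto (fun ε : ℝ => Θ (x + ε * Complex.I)) (nhdsWithin 0 (Set.Ioi 0))
      (nhds 0) := by
    have := (tendsto_argSum n fun h => lt_irrefl _ (hxn x h)).sub
      (tendsto_argSum m fun h => lt_irrefl _ (hxm x h))
    simpa [hzero n hxn, hzero m hxm] using this
  obtain ⟨w, hw, hw1, hw2⟩ : ∃ w : ℂ, 0 < w.im ∧ -1 < Θ w ∧ Θ w < 1 := by
    have h1 := hlim.eventually (Ioo_mem_nhds (show (-1 : ℝ) < 0 by norm_num) one_pos)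
    obtain ⟨ε, h, hε⟩ := (h1.and self_mem_nhdsWithin).exists
    exact ⟨x + ε * Complex.I, by simpa using hε, h.1, h.2⟩
  have hpi := Real.pi_gt_three
  have hw0 : 0 ≤ Θ w := by
    by_contra hneg
    exact absurd (hs w hw) (not_le.mpr (Real.sin_neg_of_neg_of_neg_pi_lt (not_le.mp hneg)
      (by linarith)))
  constructor
  · by_contra hneg
    have hneg : Θ z < 0 := not_le.mp hneg
    -- A negative value of `Θ` forces, by connectedness, one in `[-1, 0)`, where the sine is
    -- negative.
    obtain ⟨v, hv, hve⟩ : max (Θ z) (-1) ∈ Θ '' {z | 0 < z.im} :=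
      hconn.out ⟨z, hz, rfl⟩ ⟨w, hw, rfl⟩ ⟨le_max_left _ _, max_le (by linarith) (by linarith)⟩
    refine absurd (hs v hv) (not_le.mpr (Real.sin_neg_of_neg_of_neg_pi_lt ?_ ?_))
    · change Θ v < 0
      rw [hve]
      exact max_lt hneg (by norm_num)
    · change -Real.pi < Θ v
      rw [hve]
      exact lt_max_of_lt_right (by linarith)
  · by_contra hneg
    have hneg : Real.pi < Θ z := not_le.mp hneg
    -- The cap `π + 1 < 2π` keeps the attained value in `(π, 2π)`, where the sine is negative.
    obtain ⟨v, hv, hve⟩ : min (Θ z) (Real.pi + 1) ∈ Θ '' {z | 0 < z.im} :=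
      hconn.out ⟨w, hw, rfl⟩ ⟨z, hz, rfl⟩ ⟨le_min (by linarith) (by linarith), min_le_left _ _⟩
    refine absurd (hs v hv) (not_le.mpr ?_)
    change Real.sin (Θ v) < 0
    have h1 : Real.pi < Θ v := by rw [hve]; exact lt_min hneg (by linarith)
    have h2 : Θ v ≤ Real.pi + 1 := by rw [hve]; exact min_le_right _ _
    have h3 := Real.sin_pos_of_pos_of_lt_pi (x := Θ v - Real.pi) (by linarith) (by linarith)
    rw [Real.sin_sub_pi] at h3
    linarith

/-- As `z` descends to `x`, the angle tends to `π` times the difference of the counts. The limit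
stays in `[0, π]`, so this integer difference is `0` or `1`. -/
theorem numAbove_le_and_le_succ (m n : Multiset ℝ)
    (hs : ∀ z : ℂ, 0 < z.im → 0 ≤ Real.sin (argSum n z - argSum m z)) {x : ℝ}
    (hxm : x ∉ m) (hxn : x ∉ n) :
    numAbove m x ≤ numAbove n x ∧ numAbove n x ≤ numAbove m x + 1 := by
  have hlim := (tendsto_argSum n hxn).sub (tendsto_argSum m hxm)
  have hmem : Real.pi * numAbove n x - Real.pi * numAbove m x ∈ Set.Icc 0 Real.pi := by
    refine isClosed_Icc.mem_of_tendsto hlim ?_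
    filter_upwards [self_mem_nhdsWithin] with ε hε
    exact argSum_sub_mem_Icc m n hs (by simpa using hε)
  have hpi := Real.pi_pos
  have h1 : (numAbove m x : ℝ) ≤ numAbove n x := by
    have := hmem.1
    rw [← mul_sub] at this
    have := nonneg_of_mul_nonneg_right this hpi
    linarith
  have h2 : (numAbove n x : ℝ) ≤ numAbove m x + 1 := by
    have := hmem.2
    refine le_of_mul_le_mul_left ?_ hpi
    linarith
  exact ⟨by exact_mod_cast h1, by exact_mod_cast h2⟩

/-! ### From root counts to sorted lists of roots. -/

theorem succ_le_countP_of_lt_getElem {l : List ℝ} (hl : l.Pairwise (· ≥ ·)) {x : ℝ} {i : ℕ}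
    (hi : i < l.length) (hx : x < l[i]) : i + 1 ≤ l.countP (x < ·) := by
  have h1 : (l.take (i + 1)).countP (x < ·) = (l.take (i + 1)).length := by
    rw [List.countP_eq_length]
    intro a ha
    obtain ⟨k, hk, rfl⟩ := List.getElem_of_mem ha
    rw [List.length_take] at hk
    rw [List.getElem_take, decide_eq_true_eq]
    rcases Nat.lt_or_ge k i with hki | hki
    · exact lt_of_lt_of_le hx (List.pairwise_iff_getElem.mp hl k i (by omega) hi hki)
    · have : k = i := by omega
      subst this
      exact hx
  have h2 : (l.take (i + 1)).countP (x < ·) ≤ l.countP (x < ·) :=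
    (List.take_sublist _ _).countP_le
  rw [h1, List.length_take] at h2
  omega

theorem countP_le_of_getElem_lt {l : List ℝ} (hl : l.Pairwise (· ≥ ·)) {x : ℝ} {i : ℕ}
    (hi : i < l.length) (hx : l[i] < x) : l.countP (x < ·) ≤ i := by
  have h1 : (l.drop i).countP (x < ·) = 0 := by
    rw [List.countP_eq_zero]
    intro a ha
    obtain ⟨k, hk, rfl⟩ := List.getElem_of_mem ha
    rw [List.length_drop] at hk
    rw [List.getElem_drop, decide_eq_true_eq, not_lt]
    rcases Nat.eq_zero_or_pos k with rfl | hk0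
    · exact hx.le
    · exact le_trans (List.pairwise_iff_getElem.mp hl i (i + k) hi (by omega) (by omega)) hx.le
  have h2 : l.countP (x < ·) = (l.take i).countP (x < ·) + (l.drop i).countP (x < ·) := by
    rw [← List.countP_append, List.take_append_drop]
  have h3 : (l.take i).countP (x < ·) ≤ (l.take i).length := List.countP_le_length
  rw [List.length_take] at h3
  omega

theorem pairwise_rootsDesc (f : ℝ[X]) : (rootsDesc f).Pairwise (· ≥ ·) :=
  Multiset.pairwise_sort _ _

theorem countP_rootsDesc (f : ℝ[X]) (x : ℝ) :
    (rootsDesc f).countP (x < ·) = numAbove f.roots x := by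
  conv_rhs => rw [numAbove, ← Multiset.sort_eq f.roots (· ≥ ·)]
  rw [Multiset.coe_countP]
  rfl

theorem exists_notMem_between (m : Multiset ℝ) {a b : ℝ} (hab : a < b) :
    ∃ x, a < x ∧ x < b ∧ x ∉ m := by
  obtain ⟨x, hx, hxm⟩ := (Set.Ioo_infinite hab).exists_notMem_finset m.toFinset
  exact ⟨x, hx.1, hx.2, fun h => hxm (Multiset.mem_toFinset.mpr h)⟩

theorem IsRealRooted.splits {f : ℝ[X]} (hf : IsRealRooted f) (h0 : f ≠ 0) : f.Splits := by
  have hz := hf.resolve_left h0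
  refine Polynomial.Splits.of_splits_map (algebraMap ℝ ℂ) (IsAlgClosed.splits _) ?_
  intro z hzr
  have h1 : aeval z f = 0 := by
    have := Polynomial.isRoot_of_mem_roots hzr
    rwa [IsRoot.def, eval_map_algebraMap] at this
  exact ⟨z.re, Complex.ext (by simp) (by simp [hz z h1])⟩

theorem IsRealRooted.aeval_eq {f : ℝ[X]} (hf : IsRealRooted f) (h0 : f ≠ 0) (z : ℂ) :
    aeval z f = f.leadingCoeff * (f.roots.map fun t : ℝ => z - t).prod := by
  conv_lhs => rw [(hf.splits h0).eq_prod_roots]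
  rw [map_mul, map_multiset_prod, Multiset.map_map]
  simp

/-- Two real-rooted polynomials with positive leading coefficients interlace if their quotient maps
the upper half-plane to its closure. -/
theorem interlaces_of_im_nonneg {f g : ℝ[X]} (hf : IsRealRooted f) (hg : IsRealRooted g)
    (hfl : f ≠ 0 → 0 < f.leadingCoeff) (hgl : g ≠ 0 → 0 < g.leadingCoeff)
    (h : ∀ z : ℂ, 0 < z.im → 0 ≤ (aeval z g * (starRingEnd ℂ) (aeval z f)).im) :
    Interlaces f g := by
  refine ⟨hf, hg, ?_⟩
  by_cases hf0 : f = 0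
  · exact Or.inl hf0
  by_cases hg0 : g = 0
  · exact Or.inr (Or.inl hg0)
  refine Or.inr (Or.inr ?_)
  have hs : ∀ z : ℂ, 0 < z.im → 0 ≤ Real.sin (argSum g.roots z - argSum f.roots z) := by
    intro z hz
    have h1 := h z hz
    rw [hf.aeval_eq hf0, hg.aeval_eq hg0, prod_sub_eq_norm_mul_exp f.roots,
      prod_sub_eq_norm_mul_exp g.roots] at h1
    set M := ‖(f.roots.map fun t : ℝ => z - t).prod‖ with hM
    set N := ‖(g.roots.map fun t : ℝ => z - t).prod‖ with hN
    have hpos : 0 < g.leadingCoeff * N * (f.leadingCoeff * M) :=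
      mul_pos (mul_pos (hgl hg0) (norm_prod_sub_pos _ hz))
        (mul_pos (hfl hf0) (norm_prod_sub_pos _ hz))
    have e : ((g.leadingCoeff : ℂ) * (N * Complex.exp (argSum g.roots z * Complex.I)) *
        (starRingEnd ℂ) ((f.leadingCoeff : ℂ) *
          (M * Complex.exp (argSum f.roots z * Complex.I)))).im =
        g.leadingCoeff * N * (f.leadingCoeff * M) *
          Real.sin (argSum g.roots z - argSum f.roots z) := by
      rw [Real.sin_sub]
      simp only [Complex.exp_mul_I, ← Complex.ofReal_cos, ← Complex.ofReal_sin, map_mul, map_add,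
        Complex.conj_ofReal, Complex.conj_I, Complex.mul_im, Complex.mul_re, Complex.add_im,
        Complex.add_re, Complex.ofReal_re, Complex.ofReal_im, Complex.I_re, Complex.I_im,
        Complex.neg_re, Complex.neg_im]
      ring
    rw [e] at h1
    exact nonneg_of_mul_nonneg_right h1 hpos
  have key : ∀ x, x ∉ f.roots + g.roots →
      (rootsDesc f).countP (x < ·) ≤ (rootsDesc g).countP (x < ·) ∧
        (rootsDesc g).countP (x < ·) ≤ (rootsDesc f).countP (x < ·) + 1 := by
    intro x hx
    rw [Multiset.mem_add, not_or] at hx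
    rw [countP_rootsDesc, countP_rootsDesc]
    exact numAbove_le_and_le_succ _ _ hs hx.1 hx.2
  refine ⟨?_, ?_, ?_⟩
  -- Below all roots the counts are the lengths of the lists.
  · obtain ⟨b, hb⟩ := (f.roots + g.roots).toFinset.bddBelow
    have hlt : ∀ t ∈ f.roots + g.roots, b - 1 < t := fun t ht => by
      have := hb (Finset.mem_coe.mpr (Multiset.mem_toFinset.mpr ht)); linarith
    have hcard : ∀ k : ℝ[X], k.roots ≤ f.roots + g.roots →
        (rootsDesc k).countP (b - 1 < ·) = (rootsDesc k).length := by
      intro k hk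
      rw [List.countP_eq_length]
      intro a ha
      rw [decide_eq_true_eq]
      exact hlt a (Multiset.mem_of_le hk ((Multiset.mem_sort _).mp ha))
    have := key (b - 1) fun hmem => lt_irrefl _ (hlt _ hmem)
    rw [hcard f (Multiset.le_add_right _ _), hcard g (Multiset.le_add_left _ _)] at this
    omega
  · intro i hif hig
    by_contra hlt
    -- A non-root between two wrongly ordered roots violates the inequalities between the counts.
    obtain ⟨x, h1, h2, hx⟩ := exists_notMem_between (f.roots + g.roots) (not_le.mp hlt)
    have := succ_le_countP_of_lt_getElem (pairwise_rootsDesc f) hif h2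
    have := countP_le_of_getElem_lt (pairwise_rootsDesc g) hig h1
    have := key x hx
    omega
  · intro i hif hig
    by_contra hlt
    obtain ⟨x, h1, h2, hx⟩ := exists_notMem_between (f.roots + g.roots) (not_le.mp hlt)
    have := succ_le_countP_of_lt_getElem (pairwise_rootsDesc g) hig h2
    have := countP_le_of_getElem_lt (pairwise_rootsDesc f) hif h1
    have := key x hx
    omega

theorem leadingCoeff_pos_of_coeff_nonneg {f : ℝ[X]} (hf : ∀ i, 0 ≤ f.coeff i) (h0 : f ≠ 0) :
    0 < f.leadingCoeff :=
  lt_of_le_of_ne (hf _) (leadingCoeff_ne_zero.mpr h0).symm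

theorem isRealRooted_of_aeval_ne_zero {f : ℝ[X]}
    (h : f ≠ 0 → ∀ z : ℂ, 0 < z.im → aeval z f ≠ 0) : IsRealRooted f := by
  by_cases h0 : f = 0
  · exact Or.inl h0
  refine Or.inr fun z hz => ?_
  rcases lt_trichotomy z.im 0 with hlt | heq | hgt
  · refine absurd ?_ (h h0 ((starRingEnd ℂ) z) (by simpa using hlt))
    rw [Polynomial.aeval_conj, hz, map_zero]
  · exact heq
  · exact absurd hz (h h0 z hgt)


/-! ### Sequences of complex numbers in cyclic order -/

/-- The cross product of two complex numbers, as vectors of the plane. -/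
def crossProd (u v : ℂ) : ℝ := (v * (starRingEnd ℂ) u).im

theorem crossProd_add_left (u u' v : ℂ) : crossProd (u + u') v = crossProd u v + crossProd u' v := by
  simp [crossProd, mul_add]

theorem crossProd_add_right (u v v' : ℂ) :
    crossProd u (v + v') = crossProd u v + crossProd u v' := by
  simp [crossProd, add_mul]

theorem crossProd_self (u : ℂ) : crossProd u u = 0 := by
  simp [crossProd, Complex.mul_conj]

theorem crossProd_ofReal_mul_left (a : ℝ) (u v : ℂ) : crossProd (a * u) v = a * crossProd u v := by
  simp only [crossProd, map_mul, Complex.conj_ofReal, Complex.mul_im, Complex.mul_re,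
    Complex.ofReal_re, Complex.ofReal_im]
  ring

theorem crossProd_ofReal_mul_right (a : ℝ) (u v : ℂ) :
    crossProd u (a * v) = a * crossProd u v := by
  simp only [crossProd, Complex.mul_im, Complex.mul_re, Complex.ofReal_re, Complex.ofReal_im]
  ring

theorem crossProd_mul_self (z u : ℂ) : crossProd u (z * u) = z.im * Complex.normSq u := by
  rw [crossProd, mul_assoc, Complex.mul_conj, Complex.mul_im]
  simp

theorem crossProd_sum_left {ι : Type*} (s : Finset ι) (f : ι → ℂ) (v : ℂ) :
    crossProd (∑ i ∈ s, f i) v = ∑ i ∈ s, crossProd (f i) v := by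
  simp [crossProd, Finset.mul_sum]

theorem crossProd_sum_right {ι : Type*} (s : Finset ι) (u : ℂ) (f : ι → ℂ) :
    crossProd u (∑ i ∈ s, f i) = ∑ i ∈ s, crossProd u (f i) := by
  simp [crossProd, Finset.sum_mul]

/-- `c` is a sequence with `c (m + r) = z * c m` which turns counterclockwise, any `r` consecutive
steps amounting to the rotation by the argument of `z`. -/
structure IsTurning (z : ℂ) (r : ℕ) (c : ℕ → ℂ) : Prop where
  add_period : ∀ m, c (m + r) = z * c m
  crossProd_nonneg : ∀ a b, a ≤ b → b ≤ a + r → 0 ≤ crossProd (c a) (c b)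

namespace IsTurning

variable {z : ℂ} {r : ℕ} {c : ℕ → ℂ}

/-- The bounds give `i ≤ j ≤ i + r` for all `i` in the first range and `j` in the second. -/
theorem crossProd_sum_nonneg (hc : IsTurning z r c) {a a' b b' : ℕ} (h₁ : a' ≤ b + 1)
    (h₂ : b' ≤ a + r + 1) :
    0 ≤ crossProd (∑ i ∈ Finset.Ico a a', c i) (∑ i ∈ Finset.Ico b b', c i) := by
  rw [crossProd_sum_left]
  refine Finset.sum_nonneg fun i hi => ?_
  rw [crossProd_sum_right]
  refine Finset.sum_nonneg fun j hj => ?_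
  rw [Finset.mem_Ico] at hi hj
  exact hc.crossProd_nonneg i j (by omega) (by omega)

theorem sum_Ico_add_period (hc : IsTurning z r c) (a b : ℕ) :
    ∑ i ∈ Finset.Ico (a + r) (b + r), c i = z * ∑ i ∈ Finset.Ico a b, c i := by
  rw [← Finset.sum_Ico_add', Finset.mul_sum]
  exact Finset.sum_congr rfl fun i _ => hc.add_period i

theorem crossProd_sum_shift_nonneg (hc : IsTurning z r c) (hz : 0 < z.im) (a b : ℕ) :
    0 ≤ crossProd (∑ i ∈ Finset.Ico a b, c i) (∑ i ∈ Finset.Ico (a + r) (b + r), c i) := by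
  rw [hc.sum_Ico_add_period, crossProd_mul_self]
  exact mul_nonneg hz.le (Complex.normSq_nonneg _)

/-- Let `A`, `B`, `C` be the sums over `[a, b)`, `[b, a+r)`, `[a+r, b+r)`. The windows are `A + B`
and `B + C`; here `B × B = 0`, `C = z A` gives `A × C ≥ 0`, and the other two products compare
indices at distance at most `r`. -/
theorem sum_window (hc : IsTurning z r c) (hz : 0 < z.im) :
    IsTurning z r fun m => ∑ i ∈ Finset.Ico m (m + r), c i where
  add_period m := hc.sum_Ico_add_period m (m + r)
  crossProd_nonneg a b hab hba := by
    rw [← Finset.sum_Ico_consecutive c hab hba,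
      ← Finset.sum_Ico_consecutive c hba (Nat.add_le_add_right hab r)]
    simp only [crossProd_add_left, crossProd_add_right, crossProd_self]
    have h1 := hc.crossProd_sum_nonneg (a := a) (a' := b) (b := b) (b' := a + r) (by omega)
      (by omega)
    have h2 := hc.crossProd_sum_shift_nonneg hz a b
    have h3 := hc.crossProd_sum_nonneg (a := b) (a' := a + r) (b := a + r) (b' := b + r)
      (by omega) (by omega)
    linarith

/-- For `j ≤ k` all pairs of indices are in order and at distance at most `r`. For `j > k` the
ranges overlap and reach too far apart: both are cut in three, the overlap cancels against itself,
and the far pair `[D-j, D-k)`, `[D-j+r, D-k+r)` differs by the factor `z`. -/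
theorem crossProd_centered_nonneg (hc : IsTurning z r c) (hz : 0 < z.im) {D j k : ℕ} (hD : D ≤ r)
    (hj : 2 * j ≤ D) (hk : 2 * k ≤ D) :
    0 ≤ crossProd (∑ i ∈ Finset.Ico (D - j) (r + j), c i)
      (z * ∑ i ∈ Finset.Ico k (D - k), c i) := by
  rw [← hc.sum_Ico_add_period]
  rcases le_or_gt j k with hjk | hjk
  · exact hc.crossProd_sum_nonneg (by omega) (by omega)
  · rw [← Finset.sum_Ico_consecutive c (show D - j ≤ D - k by omega) (show D - k ≤ r + j by omega),
      ← Finset.sum_Ico_consecutive c (show D - k ≤ k + r by omega) (show k + r ≤ r + j by omega),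
      ← Finset.sum_Ico_consecutive c (show k + r ≤ r + j by omega)
        (show r + j ≤ D - k + r by omega),
      ← Finset.sum_Ico_consecutive c (show r + j ≤ D - j + r by omega)
        (show D - j + r ≤ D - k + r by omega)]
    simp only [crossProd_add_left, crossProd_add_right, crossProd_self]
    have h1 := hc.crossProd_sum_shift_nonneg hz (D - j) (D - k)
    have H := @crossProd_sum_nonneg z r c hc
    have h2 := @H (D - j) (D - k) (k + r) (r + j) (by omega) (by omega)
    have h3 := @H (D - j) (D - k) (r + j) (D - j + r) (by omega) (by omega)
    have h4 := @H (D - k) (k + r) (k + r) (r + j) (by omega) (by omega)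
    have h5 := @H (D - k) (k + r) (r + j) (D - j + r) (by omega) (by omega)
    have h6 := @H (D - k) (k + r) (D - j + r) (D - k + r) (by omega) (by omega)
    have h7 := @H (k + r) (r + j) (r + j) (D - j + r) (by omega) (by omega)
    have h8 := @H (k + r) (r + j) (D - j + r) (D - k + r) (by omega) (by omega)
    linarith

/-- Both terms are nonnegative, and if both vanished, `c m` would be parallel to `c a` and to `z * c
a`, which are independent over the reals. -/
theorem crossProd_add_crossProd_pos (hc : IsTurning z r c) (hz : 0 < z.im) {a m : ℕ}
    (ha : c a ≠ 0) (hm : c m ≠ 0) (h₁ : a ≤ m) (h₂ : m ≤ a + r) :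
    0 < crossProd (c a) (c m) + crossProd (c m) (c (a + r)) := by
  have p1 := hc.crossProd_nonneg a m h₁ h₂
  have p2 := hc.crossProd_nonneg m (a + r) h₂ (by omega)
  refine lt_of_le_of_ne (add_nonneg p1 p2) fun h0 => ?_
  have e1 : crossProd (c a) (c m) = 0 := by linarith
  have e2 : crossProd (c m) (c (a + r)) = 0 := by linarith
  rw [hc.add_period] at e2
  have hne : c m * (starRingEnd ℂ) (c a) ≠ 0 := mul_ne_zero hm (by simpa using ha)
  simp only [crossProd] at e1 e2
  have e3 : z * c a * (starRingEnd ℂ) (c m) =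
      z * (starRingEnd ℂ) (c m * (starRingEnd ℂ) (c a)) := by
    simp only [map_mul, Complex.conj_conj]
    ring
  rw [e3, Complex.mul_im, Complex.conj_im, Complex.conj_re, e1, neg_zero, mul_zero, zero_add] at e2
  exact hne (Complex.ext ((mul_eq_zero.mp e2).resolve_left hz.ne') e1)

/-- A nontrivial nonnegative combination of `r + 1` consecutive terms does not vanish. -/
theorem sum_ne_zero (hc : IsTurning z r c) (hz : 0 < z.im) (h0 : ∀ m, c m ≠ 0) {a : ℕ}
    {J : Finset ℕ} {w : ℕ → ℝ} {I : ℕ → Finset ℕ} (hw : ∀ j, 0 ≤ w j)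
    (hI : ∀ j ∈ J, ∀ m ∈ I j, a ≤ m ∧ m ≤ a + r) (hne : ∃ j ∈ J, 0 < w j ∧ (I j).Nonempty) :
    ∑ j ∈ J, (w j : ℂ) * ∑ m ∈ I j, c m ≠ 0 := by
  intro hsum
  -- The real-linear functional `W ↦ c a × W + W × c (a + r)` is positive on each `c m` that occurs,
  -- hence on the combination.
  have hpos : 0 < ∑ j ∈ J, w j *
      ∑ m ∈ I j, (crossProd (c a) (c m) + crossProd (c m) (c (a + r))) := by
    have hterm : ∀ j ∈ J, ∀ m ∈ I j, 0 < crossProd (c a) (c m) + crossProd (c m) (c (a + r)) :=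
      fun j hj m hm => hc.crossProd_add_crossProd_pos hz (h0 a) (h0 m) (hI j hj m hm).1
        (hI j hj m hm).2
    obtain ⟨j, hj, hwj, hIj⟩ := hne
    exact Finset.sum_pos' (fun j hj => mul_nonneg (hw j)
      (Finset.sum_nonneg fun m hm => (hterm j hj m hm).le))
      ⟨j, hj, mul_pos hwj (Finset.sum_pos (hterm j hj) hIj)⟩
  refine hpos.ne' ?_
  have e : ∀ W : ℂ, W = 0 → crossProd (c a) W + crossProd W (c (a + r)) = 0 := by
    rintro W rfl
    simp [crossProd]
  have := e _ hsum
  simp only [crossProd_sum_left, crossProd_sum_right, crossProd_ofReal_mul_left,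
    crossProd_ofReal_mul_right] at this
  rw [← this, ← Finset.sum_add_distrib]
  refine Finset.sum_congr rfl fun j _ => ?_
  rw [Finset.sum_add_distrib, mul_add]

end IsTurning


/-! ### Sections of the powers of `1 + t + ⋯ + t^(r-1)` -/

/-- The polynomial `1 + t + ⋯ + t^(r-1)`. -/
noncomputable def geomPoly (r : ℕ) : ℝ[X] := ∑ i ∈ Finset.range r, X ^ i

/-- The polynomial whose `n`-th coefficient is that of `t^(rn)` in `t^m (1 + ⋯ + t^(r-1))^d`. -/
noncomputable def veronese (r d m : ℕ) : ℝ[X] := contract r (X ^ m * geomPoly r ^ d)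

variable {r : ℕ}

theorem contract_sum (hr : 0 < r) {ι : Type*} (s : Finset ι) (f : ι → ℝ[X]) :
    contract r (∑ i ∈ s, f i) = ∑ i ∈ s, contract r (f i) := by
  ext n
  simp [coeff_contract hr.ne']

theorem contract_C_mul (hr : 0 < r) (a : ℝ) (f : ℝ[X]) :
    contract r (C a * f) = C a * contract r f := by
  ext n
  simp [coeff_contract hr.ne']

theorem coeff_geomPoly (r k : ℕ) : (geomPoly r).coeff k = if k < r then 1 else 0 := by
  simp [geomPoly, coeff_X_pow]

theorem coeff_mul_nonneg {f g : ℝ[X]} (hf : ∀ i, 0 ≤ f.coeff i) (hg : ∀ i, 0 ≤ g.coeff i) (i : ℕ) :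
    0 ≤ (f * g).coeff i := by
  rw [coeff_mul]
  exact Finset.sum_nonneg fun x _ => mul_nonneg (hf _) (hg _)

theorem coeff_geomPoly_pow_nonneg (r d i : ℕ) : 0 ≤ (geomPoly r ^ d).coeff i := by
  induction d generalizing i with
  | zero => rw [pow_zero, coeff_one]; split_ifs <;> norm_num
  | succ d ih =>
    rw [pow_succ]
    exact coeff_mul_nonneg ih (fun k => by rw [coeff_geomPoly]; split_ifs <;> norm_num) i

theorem coeff_veronese (hr : 0 < r) (d m n : ℕ) :
    (veronese r d m).coeff n = if m ≤ n * r then (geomPoly r ^ d).coeff (n * r - m) else 0 := by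
  rw [veronese, coeff_contract hr.ne', coeff_X_pow_mul']

theorem coeff_veronese_nonneg (hr : 0 < r) (d m n : ℕ) : 0 ≤ (veronese r d m).coeff n := by
  rw [coeff_veronese hr]
  split_ifs
  · exact coeff_geomPoly_pow_nonneg _ _ _
  · exact le_rfl

theorem veronese_add_period (hr : 0 < r) (d m : ℕ) :
    veronese r d (m + r) = X * veronese r d m := by
  rw [veronese, veronese, mul_comm X, ← contract_mul_expand hr.ne', expand_X, pow_add]
  congr 1
  ring

/-- One factor `geomPoly r` is expanded into its `r` monomials; this recursion reduces turning to
exponent `0`. -/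
theorem veronese_succ (hr : 0 < r) (d m : ℕ) :
    veronese r (d + 1) m = ∑ i ∈ Finset.Ico m (m + r), veronese r d i := by
  simp only [veronese]
  rw [← contract_sum hr, ← Finset.sum_mul, Finset.sum_Ico_eq_sum_range, add_tsub_cancel_left]
  simp only [pow_add, ← Finset.mul_sum, pow_one]
  rw [← geomPoly]
  congr 1
  ring

theorem veronese_zero (hr : 0 < r) (m : ℕ) :
    veronese r 0 m = if r ∣ m then X ^ (m / r) else 0 := by
  ext n
  rw [coeff_veronese hr, pow_zero]
  split_ifs with h1 h2 h2
  · obtain ⟨k, rfl⟩ := h2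
    rw [Nat.mul_div_cancel_left _ hr, coeff_X_pow, coeff_one]
    refine if_congr ?_ rfl rfl
    rw [mul_comm n r, ← Nat.mul_sub, mul_eq_zero]
    rw [mul_comm n r] at h1
    have := Nat.le_of_mul_le_mul_left h1 hr
    omega
  · rw [coeff_one, if_neg, coeff_zero]
    intro h
    exact h2 ⟨n, by rw [mul_comm]; omega⟩
  · obtain ⟨k, rfl⟩ := h2
    rw [Nat.mul_div_cancel_left _ hr, coeff_X_pow, if_neg]
    rintro rfl
    exact h1 (by rw [mul_comm])
  · rw [coeff_zero]

theorem isTurning_veronese (hr : 0 < r) {z : ℂ} (hz : 0 < z.im) (d : ℕ) :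
    IsTurning z r fun m => aeval z (veronese r d m) := by
  induction d with
  | zero =>
    refine ⟨fun m => by rw [veronese_add_period hr, map_mul, aeval_X], fun a b hab hba => ?_⟩
    rcases hab.eq_or_lt with rfl | hlt
    · rw [crossProd_self]
    rcases hba.eq_or_lt with rfl | hlt'
    · rw [veronese_add_period hr, map_mul, aeval_X, crossProd_mul_self]
      exact mul_nonneg hz.le (Complex.normSq_nonneg _)
    · rw [veronese_zero hr, veronese_zero hr]
      by_cases ha : r ∣ a
      · have hb : ¬ r ∣ b := by
          intro hb
          have h1 := Nat.le_of_dvd (by omega) (Nat.dvd_sub hb ha)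
          omega
        simp [hb, crossProd]
      · simp [ha, crossProd]
  | succ d ih =>
    have e : (fun m => aeval z (veronese r (d + 1) m)) =
        fun m => ∑ i ∈ Finset.Ico m (m + r), aeval z (veronese r d i) := by
      ext m
      rw [veronese_succ hr, map_sum]
    rw [e]
    exact ih.sum_window hz

/-- The exponent must be positive: `veronese r 0 m` is zero unless `r ∣ m`. -/
theorem aeval_veronese_ne_zero (hr : 0 < r) {z : ℂ} (hz : 0 < z.im) (d m : ℕ) :
    aeval z (veronese r (d + 1) m) ≠ 0 := by
  have hz0 : z ≠ 0 := by
    rintro rfl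
    simp at hz
  induction d generalizing m with
  | zero =>
    obtain ⟨k, hk1, hk2⟩ : ∃ k, m ≤ r * k ∧ r * k < m + r := by
      -- This is `m / r` rounded up; `r * k` is the only multiple of `r` in the window.
      refine ⟨(m + r - 1) / r, ?_, ?_⟩
      · have := Nat.lt_mul_div_succ (m + r - 1) hr
        rw [Nat.mul_add, mul_one] at this
        omega
      · have := Nat.mul_div_le (m + r - 1) r
        omega
    rw [veronese_succ hr, Finset.sum_eq_single (r * k)]
    · rw [veronese_zero hr, if_pos (dvd_mul_right _ _), map_pow, aeval_X]
      exact pow_ne_zero _ hz0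
    · intro i hi hik
      rw [Finset.mem_Ico] at hi
      rw [veronese_zero hr, if_neg]
      rintro ⟨l, rfl⟩
      have h1 : l < k + 1 := lt_of_mul_lt_mul_left (a := r) (by rw [Nat.mul_add]; omega) hr.le
      have h2 : k < l + 1 := lt_of_mul_lt_mul_left (a := r) (by rw [Nat.mul_add]; omega) hr.le
      exact hik (by rw [show l = k by omega])
    · intro h
      exact absurd (Finset.mem_Ico.mpr ⟨hk1, hk2⟩) h
  | succ d ih =>
    rw [veronese_succ hr, map_sum]
    have := (isTurning_veronese hr hz (d + 1)).sum_ne_zero hz ih (a := m) (J := {0})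
      (w := fun _ => 1) (I := fun _ => Finset.Ico m (m + r)) (fun _ => zero_le_one)
      (fun j _ i hi => by rw [Finset.mem_Ico] at hi; omega)
      ⟨0, by simp, one_pos, Finset.nonempty_Ico.mpr (by omega)⟩
    simpa using this

/-! ### Symmetry -/

theorem natDegree_geomPoly_pow_le (r d : ℕ) : (geomPoly r ^ d).natDegree ≤ d * (r - 1) := by
  refine natDegree_pow_le_of_le d ?_
  rw [natDegree_le_iff_coeff_eq_zero]
  intro k hk
  rw [coeff_geomPoly, if_neg (by omega)]

theorem reflect_geomPoly_pow (r d : ℕ) :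
    reflect (d * (r - 1)) (geomPoly r ^ d) = geomPoly r ^ d := by
  induction d with
  | zero => simp
  | succ d ih =>
    have h1 : reflect (r - 1) (geomPoly r) = geomPoly r := by
      ext k
      rw [coeff_reflect, coeff_geomPoly, coeff_geomPoly]
      refine if_congr ?_ rfl rfl
      rcases le_or_gt k (r - 1) with h | h
      · rw [revAt_le h]
        omega
      · rw [revAt_eq_self_of_lt h]
    have h2 : (geomPoly r).natDegree ≤ r - 1 := by
      simpa using natDegree_geomPoly_pow_le r 1
    rw [add_mul, one_mul, pow_succ, reflect_mul _ _ (natDegree_geomPoly_pow_le r d) h2, ih, h1]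

theorem coeff_veronese_eq_zero (hr : 0 < r) {d m n : ℕ} (h : d * (r - 1) + m < n * r) :
    (veronese r d m).coeff n = 0 := by
  rw [coeff_veronese hr, if_pos (by omega)]
  exact coeff_eq_zero_of_natDegree_lt
    (lt_of_le_of_lt (natDegree_geomPoly_pow_le r d) (by omega))

/-- The indices `n * r - m` and `n' * r - m'` add up to `d * (r - 1)`, the degree about which
`geomPoly r ^ d` is palindromic; out of range, both sides are zero. -/
theorem coeff_veronese_reflect (hr : 0 < r) {d m m' n n' : ℕ}
    (h : (n + n') * r = d * (r - 1) + m + m') :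
    (veronese r d m).coeff n = (veronese r d m').coeff n' := by
  rw [add_mul] at h
  rcases lt_or_ge (d * (r - 1) + m) (n * r) with h1 | h1
  · rw [coeff_veronese_eq_zero hr h1, coeff_veronese hr, if_neg (by omega)]
  rcases lt_or_ge (n * r) m with h2 | h2
  · rw [coeff_veronese hr, if_neg (by omega), coeff_veronese_eq_zero hr (by omega)]
  rw [coeff_veronese hr, coeff_veronese hr, if_pos h2, if_pos (by omega)]
  conv_lhs => rw [← reflect_geomPoly_pow, coeff_reflect, revAt_le (by omega)]
  congr 1
  omega

theorem isSymmetricPoly_of_coeff {N : ℕ} {f : ℝ[X]} (h0 : ∀ n, N < n → f.coeff n = 0)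
    (h1 : ∀ n ≤ N, f.coeff n = f.coeff (N - n)) : IsSymmetricPoly N f := by
  have hdeg : f.natDegree < N + 1 :=
    Nat.lt_succ_of_le (natDegree_le_iff_coeff_eq_zero.mpr fun n hn => h0 n hn)
  have e : toLaurent f = ∑ i ∈ Finset.range (N + 1),
      LaurentPolynomial.C (f.coeff i) * LaurentPolynomial.T i := by
    conv_lhs => rw [f.as_sum_range_C_mul_X_pow' hdeg]
    simp
  rw [IsSymmetricPoly, e, map_sum, Finset.mul_sum, ← Finset.sum_range_reflect]
  refine Finset.sum_congr rfl fun i hi => ?_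
  rw [Finset.mem_range] at hi
  rw [map_mul, LaurentPolynomial.invert_C, LaurentPolynomial.invert_T, mul_left_comm,
    ← LaurentPolynomial.T_add, h1 i (by omega)]
  congr 2
  omega


/-! ### The two parts of the decomposition -/

/-- The symmetric part of degree `d` of `U_r^{d+1} h`. -/
noncomputable def centralPart (r d : ℕ) (h : ℝ[X]) : ℝ[X] :=
  ∑ j ∈ Finset.range (h.natDegree + 1),
    C (h.coeff j) * ∑ m ∈ Finset.Ico j (d + 1 - j), veronese r d m

/-- The complement of the symmetric part of degree `d` in `U_r^{d+1} h`. -/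
noncomputable def outerPart (r d : ℕ) (h : ℝ[X]) : ℝ[X] :=
  ∑ j ∈ Finset.range (h.natDegree + 1),
    C (h.coeff j) * ∑ m ∈ Finset.Ico (d + 1 - j) (r + j), veronese r d m

/-- Multiplying `h / (1-t)^D` by `(1-t^r)^D` gives `h * geomPoly r ^ D`, and extracting every `r`-th
coefficient turns that factor into `(1-t)^D`. -/
theorem isSubseqNumerator_contract {r : ℕ} (hr : 0 < r) (D : ℕ) (h : ℝ[X]) :
    IsSubseqNumerator r D h (contract r (h * geomPoly r ^ D)) := by
  intro a ha
  have hgeom : (1 - PowerSeries.X ^ r : PowerSeries ℝ) =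
      (1 - PowerSeries.X) * (geomPoly r : PowerSeries ℝ) := by
    have e : (1 - X ^ r : ℝ[X]) = (1 - X) * geomPoly r := (mul_neg_geom_sum X r).symm
    have e' := congrArg (fun p : ℝ[X] => (p : PowerSeries ℝ)) e
    simpa only [Polynomial.coe_mul, Polynomial.coe_sub, Polynomial.coe_one, Polynomial.coe_X,
      Polynomial.coe_pow] using e'
  have key := mk_coeff_mul_one_sub_X_pow r hr D (PowerSeries.mk a)
  rw [hgeom, mul_pow, ← mul_assoc, ha, ← Polynomial.coe_pow, ← Polynomial.coe_mul] at key
  simp only [PowerSeries.coeff_mk] at key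
  rw [← key]
  ext n
  simp only [PowerSeries.coeff_mk, Polynomial.coeff_coe]
  rw [Polynomial.coeff_contract hr.ne', mul_comm r n]

theorem subseqOp_eq_contract {r : ℕ} (hr : 0 < r) (D : ℕ) (h : ℝ[X]) :
    subseqOp r D h = contract r (h * geomPoly r ^ D) :=
  (existsUnique_isSubseqNumerator r hr D h).unique (subseqOp_spec r hr D h)
    (isSubseqNumerator_contract hr D h)

theorem subseqOp_C {r : ℕ} (hr : 0 < r) (a : ℝ) : subseqOp r 1 (C a) = C a := by
  rw [subseqOp_eq_contract hr, contract_C_mul hr, pow_one]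
  have : contract r (geomPoly r) = 1 := by
    ext n
    rw [coeff_contract hr.ne', coeff_geomPoly, coeff_one]
    refine if_congr ⟨fun h => ?_, fun h => by simpa [h] using hr⟩ rfl rfl
    by_contra hn
    have := Nat.le_mul_of_pos_left r (Nat.pos_of_ne_zero hn)
    omega
  rw [this, mul_one]

theorem centralPart_add_outerPart {r d : ℕ} {h : ℝ[X]} (hr : d + 1 ≤ r)
    (hdeg : 2 * h.natDegree ≤ d + 1) :
    centralPart r d h + outerPart r d h = subseqOp r (d + 1) h := by
  have hr0 : 0 < r := by omega
  rw [subseqOp_eq_contract hr0]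
  conv_rhs => rw [h.as_sum_range_C_mul_X_pow, Finset.sum_mul, contract_sum hr0]
  rw [centralPart, outerPart, ← Finset.sum_add_distrib]
  refine Finset.sum_congr rfl fun j hj => ?_
  rw [Finset.mem_range] at hj
  rw [← mul_add, Finset.sum_Ico_consecutive _ (by omega) (by omega), add_comm r j,
    ← veronese_succ hr0, veronese, mul_assoc, contract_C_mul hr0]

theorem coeff_part_nonneg {r : ℕ} (hr : 0 < r) {h : ℝ[X]} (hnonneg : ∀ i, 0 ≤ h.coeff i) (d : ℕ)
    (J : Finset ℕ) (I : ℕ → Finset ℕ) (n : ℕ) :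
    0 ≤ (∑ j ∈ J, C (h.coeff j) * ∑ m ∈ I j, veronese r d m).coeff n := by
  simp only [finsetSum_coeff, coeff_C_mul]
  exact Finset.sum_nonneg fun j _ => mul_nonneg (hnonneg j)
    (Finset.sum_nonneg fun m _ => coeff_veronese_nonneg hr d m n)

theorem aeval_part_ne_zero {r : ℕ} (hr : 0 < r) {h : ℝ[X]} (hnonneg : ∀ i, 0 ≤ h.coeff i) (d a : ℕ)
    {J : Finset ℕ} {I : ℕ → Finset ℕ} (hI : ∀ j ∈ J, ∀ m ∈ I j, a ≤ m ∧ m ≤ a + r)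
    (h0 : ∑ j ∈ J, C (h.coeff j) * ∑ m ∈ I j, veronese r (d + 1) m ≠ 0) {z : ℂ} (hz : 0 < z.im) :
    aeval z (∑ j ∈ J, C (h.coeff j) * ∑ m ∈ I j, veronese r (d + 1) m) ≠ 0 := by
  obtain ⟨j, hj, hne⟩ := Finset.exists_ne_zero_of_sum_ne_zero h0
  have := (isTurning_veronese hr hz (d + 1)).sum_ne_zero hz (aeval_veronese_ne_zero hr hz d)
    hnonneg hI ⟨j, hj, lt_of_le_of_ne (hnonneg j) fun h => hne (by simp [← h]),
      Finset.nonempty_iff_ne_empty.mpr fun h => hne (by simp [h])⟩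
  simpa using this

theorem crossProd_outerPart_centralPart_nonneg {r d : ℕ} {h : ℝ[X]} (hr : d + 1 ≤ r)
    (hnonneg : ∀ i, 0 ≤ h.coeff i) (hdeg : 2 * h.natDegree ≤ d + 1) {z : ℂ} (hz : 0 < z.im) :
    0 ≤ crossProd (aeval z (outerPart r d h)) (z * aeval z (centralPart r d h)) := by
  simp only [outerPart, centralPart, map_sum, map_mul, aeval_C, Complex.coe_algebraMap]
  rw [crossProd_sum_left, Finset.mul_sum]
  refine Finset.sum_nonneg fun j hj => ?_
  rw [crossProd_sum_right]
  refine Finset.sum_nonneg fun k hk => ?_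
  rw [Finset.mem_range] at hj hk
  rw [mul_left_comm, crossProd_ofReal_mul_left, crossProd_ofReal_mul_right]
  exact mul_nonneg (hnonneg j) (mul_nonneg (hnonneg k)
    ((isTurning_veronese (by omega) hz d).crossProd_centered_nonneg hz hr (by omega) (by omega)))

/-! ### Symmetry, degrees and real-rootedness of the two parts. -/

theorem coeff_centralPart_reflect {r d : ℕ} (hr : 0 < r) (h : ℝ[X])
    (hdeg : 2 * h.natDegree ≤ d + 1) {n n' : ℕ} (hn : n + n' = d) :
    (centralPart r d h).coeff n = (centralPart r d h).coeff n' := by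
  simp only [centralPart, finsetSum_coeff, coeff_C_mul]
  refine Finset.sum_congr rfl fun j hj => ?_
  rw [Finset.mem_range] at hj
  congr 1
  refine Finset.sum_bij' (fun m _ => d - m) (fun m _ => d - m) ?_ ?_ ?_ ?_ ?_
  · intro m hm; rw [Finset.mem_Ico] at *; omega
  · intro m hm; rw [Finset.mem_Ico] at *; omega
  · intro m hm; rw [Finset.mem_Ico] at hm; omega
  · intro m hm; rw [Finset.mem_Ico] at hm; omega
  · intro m hm
    rw [Finset.mem_Ico] at hm
    refine coeff_veronese_reflect hr ?_
    have : d * r = d * (r - 1) + d := by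
      rw [← Nat.mul_succ, Nat.succ_eq_add_one, Nat.sub_add_cancel hr]
    rw [hn, this]
    omega

theorem coeff_outerPart_reflect {r d : ℕ} (hr : 0 < r) (h : ℝ[X])
    (hdeg : 2 * h.natDegree ≤ d + 1) {n n' : ℕ} (hn : n + n' = d + 1) :
    (outerPart r d h).coeff n = (outerPart r d h).coeff n' := by
  simp only [outerPart, finsetSum_coeff, coeff_C_mul]
  refine Finset.sum_congr rfl fun j hj => ?_
  rw [Finset.mem_range] at hj
  congr 1
  -- Indices with sum `d + r` rather than `d` move the center of symmetry from `d / 2` to `(d + 1) /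
  -- 2`.
  refine Finset.sum_bij' (fun m _ => d + r - m) (fun m _ => d + r - m) ?_ ?_ ?_ ?_ ?_
  · intro m hm; rw [Finset.mem_Ico] at *; omega
  · intro m hm; rw [Finset.mem_Ico] at *; omega
  · intro m hm; rw [Finset.mem_Ico] at hm; omega
  · intro m hm; rw [Finset.mem_Ico] at hm; omega
  · intro m hm
    rw [Finset.mem_Ico] at hm
    refine coeff_veronese_reflect hr ?_
    have : d * r = d * (r - 1) + d := by
      rw [← Nat.mul_succ, Nat.succ_eq_add_one, Nat.sub_add_cancel hr]
    rw [hn, add_mul, one_mul, this]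
    omega

theorem coeff_centralPart_eq_zero {r d : ℕ} (hr : 0 < r) (h : ℝ[X]) {n : ℕ} (hn : d < n) :
    (centralPart r d h).coeff n = 0 := by
  simp only [centralPart, finsetSum_coeff, coeff_C_mul]
  refine Finset.sum_eq_zero fun j _ => ?_
  rw [Finset.sum_eq_zero, mul_zero]
  intro m hm
  rw [Finset.mem_Ico] at hm
  refine coeff_veronese_eq_zero hr ?_
  have h1 : (d + 1) * r ≤ n * r := Nat.mul_le_mul_right r hn
  have h2 : (d + 1) * r = d * (r - 1) + d + r := by
    rw [add_mul, one_mul, ← Nat.mul_succ, Nat.succ_eq_add_one, Nat.sub_add_cancel hr]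
  omega

theorem coeff_outerPart_eq_zero {r d : ℕ} (hr : d + 1 ≤ r) (h : ℝ[X])
    (hdeg : 2 * h.natDegree ≤ d + 1) {n : ℕ} (hn : d + 1 < n) :
    (outerPart r d h).coeff n = 0 := by
  simp only [outerPart, finsetSum_coeff, coeff_C_mul]
  refine Finset.sum_eq_zero fun j hj => ?_
  rw [Finset.mem_range] at hj
  rw [Finset.sum_eq_zero, mul_zero]
  intro m hm
  rw [Finset.mem_Ico] at hm
  refine coeff_veronese_eq_zero (by omega) ?_
  have h1 : (d + 2) * r ≤ n * r := Nat.mul_le_mul_right r hn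
  have h2 : (d + 2) * r = d * (r - 1) + d + 2 * r := by
    rw [add_mul, ← Nat.mul_succ, Nat.succ_eq_add_one, Nat.sub_add_cancel (by omega)]
  omega

/-- Every index is at least `d + 1 - j ≥ 1`, so no constant term survives; this makes the outer part
divisible by `X`. -/
theorem coeff_zero_outerPart {r d : ℕ} (hr : 0 < r) (h : ℝ[X])
    (hdeg : h.natDegree ≤ d) : (outerPart r d h).coeff 0 = 0 := by
  simp only [outerPart, finsetSum_coeff, coeff_C_mul]
  refine Finset.sum_eq_zero fun j hj => ?_
  rw [Finset.mem_range] at hj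
  rw [Finset.sum_eq_zero, mul_zero]
  intro m hm
  rw [Finset.mem_Ico] at hm
  rw [coeff_veronese hr, if_neg (by omega)]

theorem isRealRooted_centralPart {r d : ℕ} {h : ℝ[X]} (hr : d + 2 ≤ r)
    (hnonneg : ∀ i, 0 ≤ h.coeff i) : IsRealRooted (centralPart r (d + 1) h) := by
  refine isRealRooted_of_aeval_ne_zero fun h0 z hz => ?_
  refine aeval_part_ne_zero (by omega) hnonneg d 0 (fun j _ m hm => ?_) h0 hz
  rw [Finset.mem_Ico] at hm
  omega

theorem aeval_outerPart_ne_zero {r d : ℕ} {h : ℝ[X]} (hr : d + 2 ≤ r)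
    (hnonneg : ∀ i, 0 ≤ h.coeff i) (hdeg : 2 * h.natDegree ≤ d + 2)
    (h0 : outerPart r (d + 1) h ≠ 0) {z : ℂ} (hz : 0 < z.im) :
    aeval z (outerPart r (d + 1) h) ≠ 0 := by
  -- The largest `j` gives the widest range, starting at `d + 2 - h.natDegree`; the degree bound
  -- keeps it within `r + 1` consecutive indices.
  refine aeval_part_ne_zero (by omega) hnonneg d (d + 2 - h.natDegree) (fun j hj m hm => ?_) h0 hz
  rw [Finset.mem_Ico] at hm
  rw [Finset.mem_range] at hj
  omega

theorem hasNonnegInterlacingSymmetricDecomposition_C (a : ℝ) (ha : 0 ≤ a) :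
    HasNonnegInterlacingSymmetricDecomposition 0 (C a) := by
  refine ⟨C a, 0, ⟨?_, ?_, by simp⟩, fun i => ?_, by simp, ?_⟩
  · simp [IsSymmetricPoly]
  · simp [IsSymmetricPoly]
  · rw [coeff_C]
    split_ifs <;> simp [ha]
  · refine ⟨Or.inl rfl, ?_, Or.inl rfl⟩
    refine isRealRooted_of_aeval_ne_zero fun h0 z _ => ?_
    rw [aeval_C]
    simpa using h0

theorem mainTheorem5 (d : ℕ) (h : ℝ[X]) (hnonneg : ∀ i, 0 ≤ h.coeff i) (hS : PropertyS h)
    (hdeg : (h.natDegree : ℝ) ≤ ((d : ℝ) + 1) / 2) (r : ℕ) (hr : d + 1 ≤ r) :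
    HasNonnegInterlacingSymmetricDecomposition d (subseqOp r (d + 1) h) := by
  have hdeg' : 2 * h.natDegree ≤ d + 1 := by
    have : (2 * h.natDegree : ℝ) ≤ d + 1 := by linarith
    exact_mod_cast this
  have hr0 : 0 < r := by omega
  cases d with
  | zero =>
    -- For `d = 0` the degree bound makes `h` constant. This case is separate because nonvanishing
    -- needs a positive exponent and `q` would have symmetry degree `-1`.
    rw [eq_C_of_natDegree_eq_zero (p := h) (by omega), zero_add, subseqOp_C hr0]
    exact hasNonnegInterlacingSymmetricDecomposition_C _ (hnonneg 0)
  | succ d =>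
    set p := centralPart r (d + 1) h with hp
    set q := divX (outerPart r (d + 1) h) with hq
    have hXq : X * q = outerPart r (d + 1) h := by
      have := divX_mul_X_add (outerPart r (d + 1) h)
      rwa [coeff_zero_outerPart hr0 h (by omega), C_0, add_zero, mul_comm] at this
    have hqc : ∀ n, q.coeff n = (outerPart r (d + 1) h).coeff (n + 1) := fun n => by
      rw [hq, coeff_divX]
    have hp0 : ∀ i, 0 ≤ p.coeff i := fun i => coeff_part_nonneg hr0 hnonneg _ _ _ i
    have hq0 : ∀ i, 0 ≤ q.coeff i := fun i => by
      rw [hqc]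
      exact coeff_part_nonneg hr0 hnonneg _ _ _ _
    have haeval : ∀ z : ℂ, aeval z (outerPart r (d + 1) h) = z * aeval z q := fun z => by
      rw [← hXq, map_mul, aeval_X]
    refine ⟨p, q, ⟨?_, ?_, ?_⟩, hp0, hq0, ?_⟩
    · exact isSymmetricPoly_of_coeff (fun n hn => coeff_centralPart_eq_zero hr0 h hn)
        fun n hn => coeff_centralPart_reflect hr0 h hdeg' (by omega)
    · rw [Nat.cast_succ, add_sub_cancel_right]
      refine isSymmetricPoly_of_coeff (fun n hn => ?_) fun n hn => ?_
      · rw [hqc]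
        rcases (show d + 1 ≤ n from hn).eq_or_lt with rfl | hlt
        · rw [coeff_outerPart_reflect hr0 h hdeg' (n' := 0) (by omega)]
          exact coeff_zero_outerPart hr0 h (by omega)
        · exact coeff_outerPart_eq_zero hr h hdeg' (by omega)
      · rw [hqc, hqc]
        exact coeff_outerPart_reflect hr0 h hdeg' (by omega)
    · rw [hXq, centralPart_add_outerPart hr hdeg']
    · refine interlaces_of_im_nonneg ?_ (isRealRooted_centralPart hr hnonneg)
        (leadingCoeff_pos_of_coeff_nonneg hq0) (leadingCoeff_pos_of_coeff_nonneg hp0)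
        fun z hz => ?_
      · refine isRealRooted_of_aeval_ne_zero fun h0 z hz => ?_
        have := aeval_outerPart_ne_zero hr hnonneg hdeg'
          (by rw [← hXq]; exact mul_ne_zero X_ne_zero h0) hz
        rw [haeval] at this
        exact right_ne_zero_of_mul this
      · have key := crossProd_outerPart_centralPart_nonneg hr hnonneg hdeg' hz
        rw [haeval, crossProd] at key
        -- The outer part is `z * q(z)`, so both factors carry `z` and the positive number `|z|²`
        -- splits off.
        have e : z * aeval z p * (starRingEnd ℂ) (z * aeval z q) =
            (Complex.normSq z : ℂ) * (aeval z p * (starRingEnd ℂ) (aeval z q)) := by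
          rw [← Complex.mul_conj, map_mul]
          ring
        rw [← hp, e, Complex.im_ofReal_mul] at key
        refine nonneg_of_mul_nonneg_right key (Complex.normSq_pos.mpr ?_)
        rintro rfl
        simp at hz
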